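/- Let $N$ be a square-free positive integer with an odd number of prime factors, and let $D=\left(\frac{a,b}{\mathbb{Q}}\right)$ (with $a,b\in\mathbb{Q}^\times$; basis $1,i,j,k$, $i^2=a$, $j^2=b$, $ij=-ji=k$) be the definite quaternion algebra over $\mathbb{Q}$ of discriminant $N$; that is, $D\otimes_{\mathbb{Q}}\mathbb{R}\not\cong M_2(\mathbb{R})$, and for every prime $p$ one has $D\otimes_{\mathbb{Q}}\mathbb{Q}_p\not\cong M_2(\mathbb{Q}_p)$ if and only if $p\mid N$. Let $\mathrm{Tr}_D$ and $N_D$ denote the reduced trace and the reduced norm of $D$. (1) There is an $x\in D$ with $\mathrm{Tr}_D(x)=0$ and $N_D(x)=1$ if and only if $N$ has no prime factor $p\equiv 1\pmod 4$. (2) There is an $x\in D$ with $\mathrm{Tr}_D(x)=1$ and $N_D(x)=1$ if and only if $N$ has no prime factor $p\equiv 1\pmod 3$. -/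

import Mathlib

open scoped Quaternion TensorProduct

namespace QuatAlg

/-- The quaternion algebra `(a, b / F)`: the `F`-algebra with basis `1, i, j, k`, where
`i ^ 2 = a`, `j ^ 2 = b` and `i * j = -(j * i) = k`. (For `a, b ≠ 0` and `2 ≠ 0` in the field `F`.) -/
abbrev Quat (F : Type*) [Field F] (a b : F) : Type _ := QuaternionAlgebra F a 0 b

variable {F : Type*} [Field F] {a b : F}

/-- The reduced trace `x + x̄`, an element of `F`; here `star` is the standard involution. -/
def reducedTrace (x : Quat F a b) : F := (x + star x).re

/-- The reduced norm `x * x̄`, an element of `F`. -/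
def reducedNorm (x : Quat F a b) : F := (x * star x).re

/-- The quaternion algebra `(a, b / F)` splits over the extension field `K` of `F`:
its base change to `K` is isomorphic to the algebra of `2 × 2` matrices over `K`. -/
def SplitOver (a b : F) (K : Type*) [Field K] [Algebra F K] : Prop :=
  Nonempty ((K ⊗[F] Quat F a b) ≃ₐ[K] Matrix (Fin 2) (Fin 2) K)

/-- A quaternion algebra over `ℚ` is definite if it is ramified at the infinite place,
that is, if it does not split over `ℝ`. -/
def IsDefinite (a b : ℚ) : Prop := ¬ SplitOver a b ℝ

/-- The quaternion algebra `(a, b / ℚ)` is ramified at the prime `p` if it does not split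
over `ℚ_[p]`. -/
def RamifiedAt (a b : ℚ) (p : ℕ) [Fact p.Prime] : Prop := ¬ SplitOver a b ℚ_[p]

/-- For a square-free positive integer `N`: the quaternion algebra `(a, b / ℚ)` has discriminant
`N`, the discriminant being the product of the primes at which the algebra is ramified. In other
words, the primes at which it is ramified are precisely the prime divisors of `N`. -/
def HasDiscriminant (a b : ℚ) (N : ℕ) : Prop :=
  ∀ (p : ℕ) [Fact p.Prime], RamifiedAt a b p ↔ p ∣ N

end QuatAlg

/-!
Let `ω` be an algebraic integer of trace `ε` and norm `1`, where `ε = 0` or `ε = 1`, and let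
`Δ = ε ^ 2 - 4` be the discriminant of `ℤ[ω]`. For `x` of reduced trace `ε` and reduced norm `1`,
the pure quaternion `2x - ε` has square `Δ`. If an odd prime `p` splits in `ℤ[ω]`, then `Δ` is a
nonzero square in `ℚ_p` by Hensel's lemma, so that `(a, b)` splits over `ℚ_p` as soon as `x` exists.

Conversely, after scaling, `a` and `b` are integers, and a nontrivial solution of
`b * z ^ 2 = x ^ 2 - a * y ^ 2` in `ℤ[ω]` is an isotropic vector of `D ⊗ ℚ(ω)`, whose two
coordinate vectors in `D` have the sought element as their quotient. Legendre's descent works over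
the Euclidean ring `ℤ[ω]` and yields a solution if all tame symbols `(a, b)_π` are squares in the
residue fields. There is no condition at infinity because `ℤ[ω]` is imaginary, and none at the
residue characteristic `2` beyond the tame one because there is only one prime above `2`.
At a prime `π` above a rational prime which does not split, the symbol of two rational integers is
always a square: either the residue field contains the square roots of all elements of `𝔽_p`, or
`p` is odd and ramified and the symbol is a square because the valuations are even. At a split prime
the symbol is a square because `(a, b)` splits over `ℚ_p`.
-/

namespace QuatAlg

/-! ### Values of the form `x ^ 2 - a * y ^ 2` -/

section NormValue

variable {R : Type*} [CommRing R] {a b c : R}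

/-- Some nonzero square multiple of `b` is a value of the form `x ^ 2 - a * y ^ 2`. Over a field of
characteristic not two, and for `a, b ≠ 0`, this says that the quaternion algebra `(a, b)` splits;
the variable `z` clears denominators, so that the notion makes sense over a domain. -/
def IsNormValue (a b : R) : Prop := ∃ x y z : R, z ≠ 0 ∧ b * z ^ 2 = x ^ 2 - a * y ^ 2

theorem isNormValue_iff_exists_eq_sq_sub {K : Type*} [Field K] {a b : K} :
    IsNormValue a b ↔ ∃ x y : K, b = x ^ 2 - a * y ^ 2 := by
  constructor
  · rintro ⟨x, y, z, hz, h⟩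
    refine ⟨x / z, y / z, ?_⟩
    field_simp
    exact h
  · rintro ⟨x, y, h⟩
    exact ⟨x, y, 1, one_ne_zero, by rw [h]; ring⟩

namespace IsNormValue

theorem sq_sub_mul_sq [Nontrivial R] (a x y : R) : IsNormValue a (x ^ 2 - a * y ^ 2) :=
  ⟨x, y, 1, one_ne_zero, by ring⟩

theorem sq [Nontrivial R] (a c : R) : IsNormValue a (c ^ 2) := ⟨c, 0, 1, one_ne_zero, by ring⟩

theorem of_map_algebraMap {K : Type*} [Field K] [Algebra R K] [IsFractionRing R K]
    (h : IsNormValue (algebraMap R K a) (algebraMap R K b)) : IsNormValue a b := by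
  obtain ⟨x, y, h⟩ := isNormValue_iff_exists_eq_sq_sub.mp h
  obtain ⟨d, hd⟩ := IsLocalization.exist_integer_multiples (nonZeroDivisors R) Finset.univ ![x, y]
  obtain ⟨x', hx'⟩ := hd 0 (Finset.mem_univ 0)
  obtain ⟨y', hy'⟩ := hd 1 (Finset.mem_univ 1)
  have : Nontrivial R := (algebraMap R K).domain_nontrivial
  refine ⟨x', y', d, nonZeroDivisors.coe_ne_zero d, IsFractionRing.injective R K ?_⟩
  simp only [map_mul, map_sub, map_pow, hx', hy', Algebra.smul_def, h,
    Matrix.cons_val_zero, Matrix.cons_val_one]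
  ring

variable [IsDomain R]

theorem mul (hb : IsNormValue a b) (hc : IsNormValue a c) : IsNormValue a (b * c) := by
  obtain ⟨x, y, z, hz, hb⟩ := hb
  obtain ⟨u, v, w, hw, hc⟩ := hc
  exact ⟨x * u + a * y * v, x * v + y * u, z * w, mul_ne_zero hz hw, by
    linear_combination c * w ^ 2 * hb + (x ^ 2 - a * y ^ 2) * hc⟩

theorem pow (hb : IsNormValue a b) (n : ℕ) : IsNormValue a (b ^ n) := by
  induction n with
  | zero => simpa using sq a 1
  | succ n ih => exact pow_succ b n ▸ ih.mul hb

theorem of_mul_sq (hc : c ≠ 0) (h : IsNormValue a (b * c ^ 2)) : IsNormValue a b := by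
  obtain ⟨x, y, z, hz, h⟩ := h
  exact ⟨x, y, c * z, mul_ne_zero hc hz, by linear_combination h⟩

theorem mul_sq_mul_sq {d : R} (hc : c ≠ 0) (h : IsNormValue a b) :
    IsNormValue (a * c ^ 2) (b * d ^ 2) := by
  obtain ⟨x, y, z, hz, h⟩ := h
  exact ⟨c * d * x, d * y, c * z, mul_ne_zero hc hz, by linear_combination c ^ 2 * d ^ 2 * h⟩

theorem of_mul_right (hb : b ≠ 0) (h : IsNormValue a (b * c)) (hab : IsNormValue a b) :
    IsNormValue a c :=
  of_mul_sq hb (by convert hab.mul h using 1; ring)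

theorem of_sq_eq_add_mul {t : R} (hc : c ≠ 0) (h : t ^ 2 = a + b * c)
    (hac : IsNormValue a c) : IsNormValue a b :=
  .of_mul_right hc (by convert sq_sub_mul_sq a t 1 using 1; linear_combination -h) hac

theorem of_isSquare_left (h2 : (2 : R) ≠ 0) (ha : a ≠ 0) (h : IsSquare a) (b : R) :
    IsNormValue a b := by
  obtain ⟨c, rfl⟩ := h
  exact ⟨c * (b + 1), b - 1, 2 * c, mul_ne_zero h2 (left_ne_zero_of_mul ha), by ring⟩

theorem symm (h2 : (2 : R) ≠ 0) (hb : b ≠ 0) (h : IsNormValue a b) : IsNormValue b a := by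
  obtain ⟨x, y, z, hz, h⟩ := h
  rcases eq_or_ne y 0 with rfl | hy
  · have hx : x ≠ 0 := by
      rintro rfl
      exact mul_ne_zero hb (pow_ne_zero 2 hz) (by linear_combination h)
    exact ⟨x * (a + 1), z * (a - 1), 2 * x, mul_ne_zero h2 hx, by
      linear_combination (a - 1) ^ 2 * h⟩
  · exact ⟨x, z, y, hy, by linear_combination h⟩

theorem of_pure_eq_sq (h2 : (2 : R) ≠ 0) (ha : a ≠ 0) {x y z s : R} (hs : s ≠ 0)
    (h : a * x ^ 2 + b * y ^ 2 - a * b * z ^ 2 = s ^ 2) : IsNormValue a b := by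
  by_cases h0 : y ^ 2 - a * z ^ 2 = 0
  · have hax : a * x ^ 2 = s ^ 2 := by linear_combination h - b * h0
    have hx : x ≠ 0 := by
      rintro rfl
      exact pow_ne_zero 2 hs (by linear_combination -hax)
    have hsq : IsNormValue (a * x ^ 2) b :=
      of_isSquare_left h2 (mul_ne_zero ha (pow_ne_zero 2 hx)) (hax ▸ IsSquare.sq s) b
    obtain ⟨u, v, w, hw, huv⟩ := hsq
    exact ⟨u, x * v, w, hw, by linear_combination huv⟩
  · refine of_mul_right h0 (b := y ^ 2 - a * z ^ 2) ?_ (sq_sub_mul_sq a y z)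
    convert sq_sub_mul_sq a s x using 1
    linear_combination h

end IsNormValue

end NormValue

/-! ### The tame symbol -/

section TameSymbol

variable {R : Type*} [CommRing R] {π a b c : R}

/-- The element `c` is a square in the residue ring `R / (π)`. -/
def IsSquareMod (π c : R) : Prop := IsSquare (Ideal.Quotient.mk (Ideal.span {π}) c)

theorem isSquareMod_iff_exists_dvd_sq_sub : IsSquareMod π c ↔ ∃ x, π ∣ x ^ 2 - c := by
  simp only [← Ideal.mem_span_singleton, ← Ideal.Quotient.eq, map_pow]
  constructor
  · rintro ⟨y, hy⟩
    obtain ⟨x, rfl⟩ := Ideal.Quotient.mk_surjective y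
    exact ⟨x, by rw [hy, pow_two]⟩
  · rintro ⟨x, hx⟩
    exact ⟨_, by rw [← hx, pow_two]⟩

namespace IsSquareMod

theorem of_isSquare (h : IsSquare c) : IsSquareMod π c := h.map _

theorem mul (hb : IsSquareMod π b) (hc : IsSquareMod π c) : IsSquareMod π (b * c) := by
  simpa only [IsSquareMod, map_mul] using IsSquare.mul hb hc

theorem of_dvd_sub (h : π ∣ a - b) (hb : IsSquareMod π b) : IsSquareMod π a := by
  rwa [IsSquareMod, (Ideal.Quotient.mk_eq_mk_iff_sub_mem a b).mpr
    (Ideal.mem_span_singleton.mpr h)]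

theorem pow (hb : IsSquareMod π b) (n : ℕ) : IsSquareMod π (b ^ n) := by
  simpa only [IsSquareMod, map_pow] using IsSquare.pow n hb

variable [IsDomain R] [IsPrincipalIdealRing R]

theorem of_mul_right (hπ : Prime π) (hb : ¬ π ∣ b) (hb' : IsSquareMod π b)
    (h : IsSquareMod π (b * c)) : IsSquareMod π c := by
  have := PrincipalIdealRing.isMaximal_of_irreducible hπ.irreducible
  let := Ideal.Quotient.field (Ideal.span {π})
  have hb0 : Ideal.Quotient.mk (Ideal.span {π}) b ≠ 0 :=
    fun h0 => hb ((Ideal.Quotient.eq_zero_iff_dvd π b).mp h0)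
  have := IsSquare.div h hb'
  rwa [map_mul, mul_div_cancel_left₀ _ hb0] at this

end IsSquareMod

/-- The tame symbol `(-1) ^ (m * n) * a ^ n / b ^ m` of `a` and `b` at `π`, where `m` and `n` are
their valuations, is a square in `R / (π)`. The quotient is replaced by a product, which is the same
up to squares, and `a` and `b` by their parts prime to `π`. -/
def TameSplit (π a b : R) : Prop :=
  ∃ (m n : ℕ) (a' b' : R), a = π ^ m * a' ∧ b = π ^ n * b' ∧ ¬ π ∣ a' ∧ ¬ π ∣ b' ∧
    IsSquareMod π ((-1) ^ (m * n) * a' ^ n * b' ^ m)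

theorem TameSplit.symm (h : TameSplit π a b) : TameSplit π b a := by
  obtain ⟨m, n, a', b', ha, hb, ha', hb', h⟩ := h
  refine ⟨n, m, b', a', hb, ha, hb', ha', ?_⟩
  convert h using 1
  ring

variable [IsDomain R]

theorem eq_and_eq_of_pow_mul_eq_pow_mul (hπ : Prime π) {m n : ℕ} (ha : ¬ π ∣ a) (hb : ¬ π ∣ b)
    (h : π ^ m * a = π ^ n * b) : m = n ∧ a = b := by
  have hle : ∀ {m n : ℕ} {a b : R}, ¬ π ∣ a → π ^ m * a = π ^ n * b → n ≤ m := by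
    intro m n a b ha h
    by_contra! hlt
    obtain ⟨k, rfl⟩ := Nat.exists_eq_add_of_lt hlt
    refine ha ⟨π ^ k * b, mul_left_cancel₀ (pow_ne_zero m hπ.ne_zero) ?_⟩
    rw [h]
    ring
  obtain rfl := le_antisymm (hle hb h.symm) (hle ha h)
  exact ⟨rfl, mul_left_cancel₀ (pow_ne_zero _ hπ.ne_zero) h⟩

theorem tameSplit_pow_mul_iff (hπ : Prime π) {m n : ℕ} (ha : ¬ π ∣ a) (hb : ¬ π ∣ b) :
    TameSplit π (π ^ m * a) (π ^ n * b) ↔ IsSquareMod π ((-1) ^ (m * n) * a ^ n * b ^ m) := by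
  constructor
  · rintro ⟨m', n', a', b', hma, hnb, ha', hb', h⟩
    obtain ⟨rfl, rfl⟩ := eq_and_eq_of_pow_mul_eq_pow_mul hπ ha ha' hma
    obtain ⟨rfl, rfl⟩ := eq_and_eq_of_pow_mul_eq_pow_mul hπ hb hb' hnb
    exact h
  · exact fun h => ⟨m, n, a, b, rfl, rfl, ha, hb, h⟩

namespace TameSplit

theorem mul (hπ : Prime π) (hab : TameSplit π a b) (hac : TameSplit π a c) :
    TameSplit π a (b * c) := by
  obtain ⟨m, n, a', b', rfl, rfl, ha', hb', hsb⟩ := hab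
  obtain ⟨m', k, a'', c', haa, rfl, ha'', hc', hsc⟩ := hac
  obtain ⟨rfl, rfl⟩ := eq_and_eq_of_pow_mul_eq_pow_mul hπ ha' ha'' haa
  refine ⟨m, n + k, a', b' * c', rfl, by ring, ha', hπ.not_dvd_mul hb' hc', ?_⟩
  convert hsb.mul hsc using 1
  ring

theorem sq_sub_of_pow_succ_dvd (hπ : Prime π) {m : ℕ} {t : R} (ha : ¬ π ∣ a)
    (ht : π ^ (m + 1) ∣ t ^ 2) : TameSplit π (π ^ m * a) (t ^ 2 - π ^ m * a) := by
  obtain ⟨s, hs⟩ := ht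
  have hnot : ¬ π ∣ π * s - a := by rwa [dvd_sub_right (dvd_mul_right π s)]
  rw [show t ^ 2 - π ^ m * a = π ^ m * (π * s - a) by rw [hs]; ring,
    tameSplit_pow_mul_iff hπ ha hnot,
    neg_one_pow_congr (n := m) (by simp [Nat.even_mul]), ← mul_pow, ← mul_pow]
  exact .pow (.of_dvd_sub (b := a ^ 2) ⟨-(s * a), by ring⟩ (.of_isSquare (.sq a))) m

section WfDvdMonoid

variable [WfDvdMonoid R]

theorem sq_right (hπ : Prime π) (ha : a ≠ 0) (hb : b ≠ 0) :
    TameSplit π a (b ^ 2) := by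
  obtain ⟨m, a', ha', rfl⟩ := WfDvdMonoid.max_power_factor ha hπ.irreducible
  obtain ⟨n, b', hb', rfl⟩ := WfDvdMonoid.max_power_factor hb hπ.irreducible
  rw [mul_pow, ← pow_mul, tameSplit_pow_mul_iff hπ ha' (mt hπ.dvd_of_dvd_pow hb')]
  exact .of_isSquare ⟨(-1) ^ (m * n) * a' ^ n * b' ^ m, by ring⟩

theorem mul_sq_mul_sq (hπ : Prime π) (ha : a ≠ 0) (hb : b ≠ 0) (hc : c ≠ 0)
    (h : TameSplit π a b) : TameSplit π (a * c ^ 2) (b * c ^ 2) :=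
  have hbc : TameSplit π a (b * c ^ 2) := h.mul hπ (sq_right hπ ha hc)
  (hbc.symm.mul hπ (sq_right hπ (mul_ne_zero hb (pow_ne_zero 2 hc)) hc)).symm

theorem sq_sub_of_not_dvd (hπ : Prime π) {t : R} (ht : ¬ π ∣ t) (ha : a ≠ 0)
    (h0 : t ^ 2 - a ≠ 0) : TameSplit π a (t ^ 2 - a) := by
  obtain ⟨m, a', ha', rfl⟩ := WfDvdMonoid.max_power_factor ha hπ.irreducible
  obtain ⟨n, b', hb', hb⟩ := WfDvdMonoid.max_power_factor h0 hπ.irreducible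
  rw [hb, tameSplit_pow_mul_iff hπ ha' hb']
  have hmn : m = 0 ∨ n = 0 := by
    by_contra! h
    refine ht (hπ.dvd_of_dvd_pow (n := 2) ?_)
    rw [← sub_add_cancel (t ^ 2) (π ^ m * a'), hb]
    exact dvd_add ((dvd_pow_self π h.2).mul_right b') ((dvd_pow_self π h.1).mul_right a')
  have hsq : IsSquareMod π (t ^ 2) := .of_isSquare (.sq t)
  rcases hmn with rfl | rfl
  · rcases eq_or_ne n 0 with rfl | hn
    · exact .of_isSquare (by simp)
    · have ha't : IsSquareMod π a' := .of_dvd_sub (b := t ^ 2) (by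
        rw [← dvd_neg]
        convert (dvd_pow_self π hn).mul_right b' using 1
        rw [← hb]
        ring) hsq
      simpa using ha't.pow n
  · rcases eq_or_ne m 0 with rfl | hm
    · exact .of_isSquare (by simp)
    · have hb't : IsSquareMod π b' := .of_dvd_sub (b := t ^ 2) (by
        rw [← dvd_neg]
        convert (dvd_pow_self π hm).mul_right a' using 1
        linear_combination hb) hsq
      simpa using hb't.pow m

theorem sq_sub (hπ : Prime π) (ha : a ≠ 0) {t : R} (h0 : t ^ 2 - a ≠ 0) :
    TameSplit π a (t ^ 2 - a) := by
  obtain ⟨m, a', ha', rfl⟩ := WfDvdMonoid.max_power_factor ha hπ.irreducible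
  by_cases hdvd : π ^ (m + 1) ∣ t ^ 2
  · exact sq_sub_of_pow_succ_dvd hπ ha' hdvd
  have ht : t ≠ 0 := by rintro rfl; simp at hdvd
  obtain ⟨r, t', ht', rfl⟩ := WfDvdMonoid.max_power_factor ht hπ.irreducible
  have hrm : r * 2 ≤ m := by
    by_contra! hlt
    exact hdvd (mul_pow (π ^ r) t' 2 ▸ pow_mul π r 2 ▸ (pow_dvd_pow π hlt).mul_right _)
  obtain ⟨k, rfl⟩ := Nat.exists_eq_add_of_le hrm
  have hr : π ^ r ≠ 0 := pow_ne_zero r hπ.ne_zero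
  have hk : π ^ k * a' ≠ 0 := mul_ne_zero (pow_ne_zero k hπ.ne_zero) (right_ne_zero_of_mul ha)
  have hfactor : (π ^ r * t') ^ 2 - π ^ (r * 2 + k) * a' = (t' ^ 2 - π ^ k * a') * (π ^ r) ^ 2 := by
    ring
  have h0' := left_ne_zero_of_mul (hfactor ▸ h0)
  rw [hfactor, show π ^ (r * 2 + k) * a' = π ^ k * a' * (π ^ r) ^ 2 by ring]
  exact mul_sq_mul_sq hπ hk h0' hr (sq_sub_of_not_dvd hπ ht' hk h0')

end WfDvdMonoid

variable [IsPrincipalIdealRing R]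

theorem of_mul_right (hπ : Prime π) (hc : c ≠ 0) (hab : TameSplit π a b)
    (habc : TameSplit π a (b * c)) : TameSplit π a c := by
  obtain ⟨m, n, a', b', rfl, rfl, ha', hb', hsb⟩ := hab
  obtain ⟨k, c', hc', rfl⟩ := WfDvdMonoid.max_power_factor hc hπ.irreducible
  rw [tameSplit_pow_mul_iff hπ ha' hc']
  rw [show π ^ n * b' * (π ^ k * c') = π ^ (n + k) * (b' * c') by ring,
    tameSplit_pow_mul_iff hπ ha' (hπ.not_dvd_mul hb' hc')] at habc
  have hone : ¬ π ∣ (-1) ^ (m * n) :=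
    mt (isUnit_of_dvd_unit · (isUnit_one.neg.pow _)) hπ.not_isUnit
  have hsym : ¬ π ∣ (-1) ^ (m * n) * a' ^ n * b' ^ m :=
    hπ.not_dvd_mul (hπ.not_dvd_mul hone (mt hπ.dvd_of_dvd_pow ha')) (mt hπ.dvd_of_dvd_pow hb')
  exact .of_mul_right hπ hsym hsb (by convert habc using 1; ring)

theorem of_mul_sq_right (hπ : Prime π) (ha : a ≠ 0) (hb : b ≠ 0) (hc : c ≠ 0)
    (h : TameSplit π a (b * c ^ 2)) : TameSplit π a b :=
  of_mul_right hπ hb (sq_right hπ ha hc) (by rwa [mul_comm])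

theorem of_mul_sq_left (hπ : Prime π) (ha : a ≠ 0) (hb : b ≠ 0) (hc : c ≠ 0)
    (h : TameSplit π (a * c ^ 2) b) : TameSplit π a b :=
  (of_mul_sq_right hπ hb ha hc h.symm).symm

end TameSplit

theorem IsNormValue.tameSplit [IsPrincipalIdealRing R] (hπ : Prime π) (ha : a ≠ 0) (hb : b ≠ 0)
    (h : IsNormValue a b) : TameSplit π a b := by
  obtain ⟨x, y, z, hz, h⟩ := h
  have hbz : b * z ^ 2 ≠ 0 := mul_ne_zero hb (pow_ne_zero 2 hz)
  refine .of_mul_sq_right hπ ha hb hz (c := z) ?_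
  rcases eq_or_ne y 0 with rfl | hy
  · have hx : x ≠ 0 := by
      rintro rfl
      exact hbz (by linear_combination h)
    convert TameSplit.sq_right hπ ha hx using 1
    linear_combination h
  · refine .of_mul_sq_left hπ ha hbz hy ?_
    rw [h] at hbz ⊢
    exact .sq_sub hπ (mul_ne_zero ha (pow_ne_zero 2 hy)) hbz

end TameSymbol

/-! ### Legendre's descent -/

section Descent

variable {R : Type*} [CommRing R]

theorem IsSquareMod.of_tameSplit {π a b : R} (hπ : Prime π) (hb : Squarefree b) (hdvd : π ∣ b)
    (h : TameSplit π a b) : IsSquareMod π a := by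
  obtain ⟨m, n, a', b', rfl, rfl, -, hb', h⟩ := h
  have hn : n = 1 := by
    have hn0 : n ≠ 0 := by
      rintro rfl
      exact hb' (by simpa using hdvd)
    have hn2 : ¬ 2 ≤ n := fun h2 =>
      hπ.not_isUnit (hb π (pow_two π ▸ (pow_dvd_pow π h2).mul_right b'))
    lia
  subst hn
  rcases eq_or_ne m 0 with rfl | hm
  · simpa using h
  · exact .of_dvd_sub (b := 0) (by simpa using (dvd_pow_self π hm).mul_right a')
      (.of_isSquare .zero)

theorem IsSquareMod.mul_left_of_isCoprime {a b c : R} (h : IsCoprime b c) (hb : IsSquareMod b a)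
    (hc : IsSquareMod c a) : IsSquareMod (b * c) a := by
  rw [isSquareMod_iff_exists_dvd_sq_sub] at hb hc ⊢
  obtain ⟨x, hx⟩ := hb
  obtain ⟨y, hy⟩ := hc
  obtain ⟨u, v, huv⟩ := id h
  obtain ⟨r, hr⟩ := hx
  obtain ⟨s, hs⟩ := hy
  refine ⟨y * u * b + x * v * c, h.mul_dvd ?_ ?_⟩
  · exact ⟨r + u * (y - x) * (y * u * b + x * v * c + x), by
      linear_combination hr + (x * (y * u * b + x * v * c + x)) * huv⟩
  · exact ⟨s + v * (x - y) * (y * u * b + x * v * c + y), by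
      linear_combination hs + (y * (y * u * b + x * v * c + y)) * huv⟩

variable [IsDomain R] [IsPrincipalIdealRing R]

theorem isSquareMod_of_forall_prime {a b : R} (hb : Squarefree b)
    (h : ∀ π, Prime π → π ∣ b → IsSquareMod π a) : IsSquareMod b a := by
  induction b using UniqueFactorizationMonoid.induction_on_prime with
  | h₁ => exact absurd hb not_squarefree_zero
  | h₂ b hunit => exact isSquareMod_iff_exists_dvd_sq_sub.mpr ⟨0, hunit.dvd⟩
  | h₃ b π _ hπ ih =>
    have hcop : IsCoprime π b := (IsRelPrime.of_squarefree_mul hb).isCoprime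
    exact .mul_left_of_isCoprime hcop (h π hπ (dvd_mul_right π b))
      (ih hb.of_mul_right fun ρ hρ hρb => h ρ hρ (hρb.mul_left π))

theorem TameSplit.of_sq_eq_add_mul {π a b c t : R} (hπ : Prime π) (ha : a ≠ 0) (hb : b ≠ 0)
    (hc : c ≠ 0) (h : t ^ 2 = a + b * c) (hab : TameSplit π a b) : TameSplit π a c := by
  have hbc : b * c = t ^ 2 - a := by linear_combination -h
  exact .of_mul_right hπ hc hab (hbc ▸ .sq_sub hπ ha (hbc ▸ mul_ne_zero hb hc))

theorem isNormValue_of_forall_tameSplit (N : R →*₀ ℕ) (hN : ∀ k, N k = 1 → IsUnit k)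
    (hN0 : ∀ k, N k = 0 → k = 0) (h2 : (2 : R) ≠ 0)
    (hstep : ∀ a b : R, a ≠ 0 → Squarefree b → N a ≤ N b → IsSquareMod b a →
      IsNormValue a b ∨ ∃ t c, t ^ 2 = a + b * c ∧ N c < N b)
    {a b : R} (ha : a ≠ 0) (hb : b ≠ 0) (h : ∀ π, Prime π → TameSplit π a b) :
    IsNormValue a b := by
  induction hn : N a + N b using Nat.strong_induction_on generalizing a b with
  | _ n ih =>
  subst hn
  wlog hle : N a ≤ N b generalizing a b
  · exact (this hb ha (fun π hπ => (h π hπ).symm)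
      (by rwa [add_comm (N b)]) (le_of_not_ge hle)).symm h2 ha
  by_cases hsq : Squarefree b
  · have hmod := isSquareMod_of_forall_prime hsq fun π hπ hdvd =>
      .of_tameSplit hπ hsq hdvd (h π hπ)
    obtain hab | ⟨t, c, ht, hlt⟩ := hstep a b ha hsq hle hmod
    · exact hab
    rcases eq_or_ne c 0 with rfl | hc
    · exact .of_isSquare_left h2 ha ⟨t, by linear_combination -ht⟩ b
    exact .of_sq_eq_add_mul hc ht (ih (N a + N c) (by lia) ha hc
      (fun π hπ => .of_sq_eq_add_mul hπ ha hb hc ht (h π hπ)) rfl)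
  · simp only [Squarefree, not_forall] at hsq
    obtain ⟨k, ⟨s, rfl⟩, hk⟩ := hsq
    rw [← pow_two, mul_comm] at hb h ih ⊢
    obtain ⟨hs, hk0⟩ := mul_ne_zero_iff.mp hb
    replace hk0 : k ≠ 0 := (pow_ne_zero_iff two_ne_zero).mp hk0
    have hlt : N s < N (s * k ^ 2) := by
      have hks : 1 < N k := by grind
      have hs1 : 0 < N s := by grind
      rw [map_mul, map_pow]
      exact lt_mul_of_one_lt_right hs1 (one_lt_pow₀ hks two_ne_zero)
    have := ih (N a + N s) (by lia) ha hs (fun π hπ => .of_mul_sq_right hπ ha hs hk0 (h π hπ)) rfl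
    exact this.mul (.sq a k)

end Descent

/-! ### The Gaussian and Eisenstein integers -/

/-- The ring `ℤ[ω]`, where `ω` has trace `ε` and norm `1`, that is, `ω ^ 2 = ε * ω - 1`. For
`ε = 0` these are the Gaussian integers and for `ε = 1` or `ε = -1` the Eisenstein integers. -/
abbrev ZOmega (ε : ℤ) : Type := QuadraticAlgebra ℤ (-1) ε

theorem exists_abs_sub_two_mul_mul_le (c : ℤ) {n : ℤ} (hn : 0 < n) :
    ∃ q, |c - 2 * n * q| ≤ n := by
  refine ⟨(c + n) / (2 * n), abs_le.mpr ?_⟩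
  have := Int.emod_nonneg (c + n) (by lia : 2 * n ≠ 0)
  have := Int.emod_lt_of_pos (c + n) (by lia : 0 < 2 * n)
  have := Int.emod_add_mul_ediv (c + n) (2 * n)
  constructor <;> lia

namespace ZOmega

open QuadraticAlgebra

variable {ε : ℤ}

theorem norm_eq (x : ZOmega ε) : norm x = x.re ^ 2 + ε * x.re * x.im + x.im ^ 2 := by
  rw [norm_def]; ring

theorem four_mul_norm (x : ZOmega ε) :
    4 * norm x = (2 * x.re + ε * x.im) ^ 2 + (4 - ε ^ 2) * x.im ^ 2 := by
  rw [norm_eq]; ring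

/-- The absolute norm on `ℤ[ω]`. -/
def natNorm (ε : ℤ) : ZOmega ε →*₀ ℕ where
  toFun x := (norm x).natAbs
  map_zero' := by simp
  map_one' := by simp
  map_mul' := by simp [Int.natAbs_mul]

theorem isUnit_of_natNorm_eq_one {x : ZOmega ε} (h : natNorm ε x = 1) : IsUnit x := by
  rw [isUnit_iff_norm_isUnit, Int.isUnit_iff_natAbs_eq]
  exact h

theorem omega_sq : (ω : ZOmega ε) ^ 2 = (ε : ZOmega ε) * ω - 1 := by
  ext <;> simp [pow_two]

section Euclidean

instance : Fact ((0 : ℤ) ^ 2 < 4) := ⟨by norm_num⟩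

instance : Fact ((1 : ℤ) ^ 2 < 4) := ⟨by norm_num⟩

variable [hε : Fact (ε ^ 2 < 4)]

theorem norm_nonneg (x : ZOmega ε) : 0 ≤ norm x := by
  have := four_mul_norm x
  have : 0 ≤ (4 - ε ^ 2) * x.im ^ 2 := mul_nonneg (by linarith [hε.out]) (sq_nonneg _)
  nlinarith [sq_nonneg (2 * x.re + ε * x.im)]

theorem natNorm_cast (x : ZOmega ε) : (natNorm ε x : ℤ) = norm x :=
  Int.natAbs_of_nonneg (norm_nonneg x)

theorem norm_eq_zero_iff {x : ZOmega ε} : norm x = 0 ↔ x = 0 := by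
  refine ⟨fun h => ?_, fun h => by simp [h]⟩
  have him : x.im = 0 := by
    by_contra him
    nlinarith [four_mul_norm x, sq_nonneg (2 * x.re + ε * x.im), sq_pos_of_ne_zero him, hε.out]
  rw [norm_eq, him] at h
  ext
  · simpa using h
  · exact him

theorem norm_pos {x : ZOmega ε} (hx : x ≠ 0) : 0 < norm x :=
  (norm_nonneg x).lt_of_ne' (norm_eq_zero_iff.not.mpr hx)

instance : IsDomain (ZOmega ε) :=
  have : NoZeroDivisors (ZOmega ε) :=
    ⟨fun h => by simpa only [← norm_eq_zero_iff, ← mul_eq_zero, ← map_mul] using h⟩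
  NoZeroDivisors.to_isDomain _

theorem exists_norm_sub_intCast_mul_le (y : ZOmega ε) {n : ℤ} (hn : 0 < n) :
    ∃ q : ZOmega ε, 16 * norm (y - (n : ZOmega ε) * q) ≤ (8 - ε ^ 2) * n ^ 2 := by
  obtain ⟨v, hv⟩ := exists_abs_sub_two_mul_mul_le (2 * y.im) hn
  obtain ⟨u, hu⟩ := exists_abs_sub_two_mul_mul_le (2 * y.re + ε * (y.im - n * v)) hn
  refine ⟨⟨u, v⟩, ?_⟩
  have h4 := four_mul_norm (y - (n : ZOmega ε) * ⟨u, v⟩)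
  have hre : (y - (n : ZOmega ε) * ⟨u, v⟩).re = y.re - n * u := by simp
  have him : (y - (n : ZOmega ε) * ⟨u, v⟩).im = y.im - n * v := by simp
  rw [hre, him] at h4
  have hu2 := sq_le_sq' (abs_le.mp hu).1 (abs_le.mp hu).2
  have hv2 := sq_le_sq' (abs_le.mp hv).1 (abs_le.mp hv).2
  have := mul_le_mul_of_nonneg_left hv2 (by linarith [hε.out] : 0 ≤ 4 - ε ^ 2)
  linarith

theorem exists_norm_sub_mul_le (x : ZOmega ε) {b : ZOmega ε} (hb : b ≠ 0) :
    ∃ q, 16 * norm (x - b * q) ≤ (8 - ε ^ 2) * norm b := by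
  obtain ⟨q, hq⟩ := exists_norm_sub_intCast_mul_le (x * star b) (norm_pos hb)
  refine ⟨q, le_of_mul_le_mul_right ?_ (norm_pos hb)⟩
  have hscale : x * star b - ((norm b : ℤ) : ZOmega ε) * q = (x - b * q) * star b := by
    rw [← eq_intCast (algebraMap ℤ (ZOmega ε)), algebraMap_norm_eq_mul_star]
    ring
  rw [hscale, map_mul, QuadraticAlgebra.norm_star] at hq
  linarith

theorem exists_natNorm_sub_mul_lt (x : ZOmega ε) {b : ZOmega ε} (hb : b ≠ 0) :
    ∃ q, natNorm ε (x - b * q) < natNorm ε b := by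
  obtain ⟨q, hq⟩ := exists_norm_sub_mul_le x hb
  refine ⟨q, ?_⟩
  zify
  rw [natNorm_cast, natNorm_cast]
  nlinarith [norm_pos hb, sq_nonneg ε]

theorem natNorm_ne_zero {x : ZOmega ε} (hx : x ≠ 0) : natNorm ε x ≠ 0 :=
  Int.natAbs_ne_zero.mpr (norm_pos hx).ne'

noncomputable instance : EuclideanDomain (ZOmega ε) where
  quotient x b := open Classical in
    if hb : b = 0 then 0 else (exists_natNorm_sub_mul_lt x hb).choose
  quotient_zero x := by simp
  remainder x b := open Classical in
    x - b * if hb : b = 0 then 0 else (exists_natNorm_sub_mul_lt x hb).choose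
  quotient_mul_add_remainder_eq x b := by simp
  r := InvImage (· < ·) (natNorm ε)
  r_wellFounded := InvImage.wf _ wellFounded_lt
  remainder_lt x b hb := by
    simpa [InvImage, hb] using (exists_natNorm_sub_mul_lt x hb).choose_spec
  mul_left_not_lt x b hb := by
    rw [InvImage, map_mul, not_lt]
    exact Nat.le_mul_of_pos_right _ (Nat.pos_of_ne_zero (natNorm_ne_zero hb))

theorem norm_mul_norm_le {a b c t : ZOmega ε} (h : t ^ 2 = a + b * c) :
    norm b * norm c ≤ 2 * norm t ^ 2 + 2 * norm a := by
  have hpar : norm (t ^ 2 - a) + norm (t ^ 2 + a) = 2 * norm (t ^ 2) + 2 * norm a := by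
    simp only [norm_eq, re_sub, im_sub, re_add, im_add]
    ring
  rw [← map_mul, show b * c = t ^ 2 - a by linear_combination -h, ← map_pow, ← hpar]
  linarith [norm_nonneg (t ^ 2 + a)]

theorem exists_sq_eq_add_mul {a b : ZOmega ε} (hb : b ≠ 0) (h : IsSquareMod b a) :
    ∃ t c, t ^ 2 = a + b * c ∧ 16 * norm t ≤ (8 - ε ^ 2) * norm b := by
  obtain ⟨x, c, hc⟩ := isSquareMod_iff_exists_dvd_sq_sub.mp h
  obtain ⟨q, hq⟩ := exists_norm_sub_mul_le x hb
  exact ⟨x - b * q, c - 2 * x * q + b * q ^ 2, by linear_combination hc, hq⟩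

theorem sq_eq_zero_or_sq_eq_one : ε ^ 2 = 0 ∨ ε ^ 2 = 1 := by
  have := abs_lt_of_sq_lt_sq' (by simpa using hε.out : ε ^ 2 < 2 ^ 2) zero_le_two
  obtain ⟨h₁, h₂⟩ := this
  interval_cases ε <;> simp

-- The bound `5 - 2 * ε ^ 2` is `5` for the Gaussian and `3` for the Eisenstein integers; it leaves
-- only finitely many `b` to be treated by hand.
theorem norm_lt_of_sq_eq_add_mul {a b c t : ZOmega ε} (h : t ^ 2 = a + b * c)
    (hab : norm a ≤ norm b) (ht : 16 * norm t ≤ (8 - ε ^ 2) * norm b)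
    (hlarge : 5 - 2 * ε ^ 2 ≤ norm b) : norm c < norm b := by
  have hmul := norm_mul_norm_le h
  have h0 := norm_nonneg t
  rcases sq_eq_zero_or_sq_eq_one (ε := ε) with he | he <;> rw [he] at ht hlarge
  · nlinarith
  · by_contra! hle
    have : norm b ≤ 3 := by nlinarith
    have : norm b = 3 := by lia
    have : norm t ≤ 1 := by lia
    nlinarith

theorem abs_re_le_one_and_abs_im_le_one {x : ZOmega ε}
    (h : norm x ≤ 2) : |x.re| ≤ 1 ∧ |x.im| ≤ 1 := by
  rw [norm_eq] at h
  simp only [← sq_le_one_iff_abs_le_one]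
  have hlt {c : ℤ} (hc : 3 * c ^ 2 ≤ 8) : c ^ 2 ≤ 1 := by
    rw [sq_le_one_iff_abs_le_one, abs_le]
    constructor <;> nlinarith
  rcases sq_eq_zero_or_sq_eq_one (ε := ε) with he | he
  · obtain rfl : ε = 0 := by simpa using he
    constructor <;> apply hlt <;> nlinarith
  · constructor <;> apply hlt
    · nlinarith [sq_nonneg (ε * x.re + 2 * x.im)]
    · nlinarith [sq_nonneg (2 * x.re + ε * x.im)]

end Euclidean

section Eisenstein

theorem eq_sq_sq_or_eq_neg_sq_sq (hε : ε ^ 2 = 1) {x : ZOmega ε}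
    (h : norm x ≤ 2) : x = (x ^ 2) ^ 2 ∨ x = -(x ^ 2) ^ 2 := by
  have : Fact (ε ^ 2 < 4) := ⟨by lia⟩
  obtain ⟨hr, hs⟩ := abs_re_le_one_and_abs_im_le_one h
  obtain ⟨r, s⟩ := x
  rw [norm_eq] at h
  rw [abs_le] at hr hs
  obtain ⟨hr₁, hr₂⟩ := hr
  obtain ⟨hs₁, hs₂⟩ := hs
  dsimp only at *
  rcases sq_eq_one_iff.mp hε with rfl | rfl <;> interval_cases r <;> interval_cases s <;>
    first | (exfalso; revert h; decide) | decide

theorem isNormValue_neg_sq_neg_sq (hε : ε ^ 2 = 1) {y : ZOmega ε} (hy : y ≠ 0)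
    (z : ZOmega ε) : IsNormValue (-y ^ 2) (-z ^ 2) := by
  have hε' : (ε : ZOmega ε) ^ 2 = 1 := by exact_mod_cast congrArg (Int.cast (R := ZOmega ε)) hε
  refine ⟨ω * z * y, ω ^ 2 * z, y, hy, ?_⟩
  have h := omega_sq (ε := ε)
  linear_combination (-(z ^ 2 * y ^ 2)) * (ω ^ 2 + (ε : ZOmega ε) * ω + 1) * h
    - z ^ 2 * y ^ 2 * ω ^ 2 * hε'

theorem isNormValue_of_norm_le_two_of_sq_eq_one (hε : ε ^ 2 = 1)
    {a b : ZOmega ε} (ha : a ≠ 0) (hab : norm a ≤ norm b) (h : norm b ≤ 2) :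
    IsNormValue a b := by
  have : Fact (ε ^ 2 < 4) := ⟨by lia⟩
  rcases eq_sq_sq_or_eq_neg_sq_sq hε (hab.trans h) with ha' | ha'
  · exact .of_isSquare_left two_ne_zero ha (ha' ▸ .sq _) b
  rcases eq_sq_sq_or_eq_neg_sq_sq hε h with hb' | hb'
  · rw [hb']
    exact .sq _ _
  · rw [ha', hb']
    exact isNormValue_neg_sq_neg_sq hε (pow_ne_zero 2 ha) _

end Eisenstein

section Gaussian

theorem omega_sq_zero : (ω : ZOmega 0) ^ 2 = -1 := by simpa using omega_sq (ε := 0)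

theorem exists_eq_omega_pow_mul {x : ZOmega 0} (hx : x ≠ 0) (h : norm x ≤ 2) :
    ∃ j k : ℕ, x = ω ^ j * (1 + ω) ^ k := by
  obtain ⟨hr, hs⟩ := abs_re_le_one_and_abs_im_le_one h
  obtain ⟨r, s⟩ := x
  rw [abs_le] at hr hs
  obtain ⟨hr₁, hr₂⟩ := hr
  obtain ⟨hs₁, hs₂⟩ := hs
  dsimp only at *
  interval_cases r <;> interval_cases s
  · exact ⟨2, 1, by decide⟩
  · exact ⟨2, 0, by decide⟩
  · exact ⟨1, 1, by decide⟩
  · exact ⟨3, 0, by decide⟩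
  · exact absurd rfl hx
  · exact ⟨1, 0, by decide⟩
  · exact ⟨3, 1, by decide⟩
  · exact ⟨0, 0, by decide⟩
  · exact ⟨0, 1, by decide⟩

theorem norm_le_two_of_squarefree {b : ZOmega 0} (hb : Squarefree b) (h : norm b ≤ 4) :
    norm b ≤ 2 := by
  by_contra! h2
  obtain ⟨r, s⟩ := b
  have hdvd : 2 ∣ r ∧ 2 ∣ s := by
    rw [norm_eq] at h h2
    dsimp only at h h2
    have hr : -2 ≤ r ∧ r ≤ 2 := by constructor <;> nlinarith
    have hs : -2 ≤ s ∧ s ≤ 2 := by constructor <;> nlinarith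
    obtain ⟨hr₁, hr₂⟩ := hr
    obtain ⟨hs₁, hs₂⟩ := hs
    interval_cases r <;> interval_cases s <;> lia
  obtain ⟨⟨u, rfl⟩, v, rfl⟩ := hdvd
  have hunit := hb (1 + ω) ⟨⟨v, -u⟩, by ext <;> simp⟩
  rw [isUnit_iff_norm_isUnit] at hunit
  revert hunit
  decide

theorem isNormValue_omega_pow_mul (j k m n : ℕ) :
    IsNormValue ((ω : ZOmega 0) ^ j * (1 + ω) ^ k) (ω ^ m * (1 + ω) ^ n) := by
  have hω : (ω : ZOmega 0) ≠ 0 := by decide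
  have hω' : (1 + ω : ZOmega 0) ≠ 0 := by decide
  have h := omega_sq_zero
  have h₁ : IsNormValue (ω : ZOmega 0) ω := ⟨0, 1, ω, hω, by linear_combination ω * h⟩
  have h₂ : IsNormValue (ω : ZOmega 0) (1 + ω) :=
    ⟨1, ω, 1, one_ne_zero, by linear_combination ω * h⟩
  have h₃ : IsNormValue (1 + ω : ZOmega 0) (1 + ω) :=
    ⟨0, 1, ω, hω, by linear_combination (1 + ω) * h⟩
  have hl (c : ZOmega 0) (hc : c ≠ 0) (h₁ : IsNormValue ω c) (h₂ : IsNormValue (1 + ω) c) :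
    IsNormValue (ω ^ j * (1 + ω) ^ k) c :=
    (((h₁.symm two_ne_zero hc).pow j).mul ((h₂.symm two_ne_zero hc).pow k)).symm two_ne_zero
      (mul_ne_zero (pow_ne_zero j hω) (pow_ne_zero k hω'))
  exact ((hl ω hω h₁ (h₂.symm two_ne_zero hω')).pow m).mul ((hl _ hω' h₂ h₃).pow n)

theorem isNormValue_of_norm_le_two {a b : ZOmega 0} (ha : a ≠ 0) (hb : b ≠ 0)
    (hab : norm a ≤ norm b) (h : norm b ≤ 2) : IsNormValue a b := by
  obtain ⟨j, k, rfl⟩ := exists_eq_omega_pow_mul ha (hab.trans h)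
  obtain ⟨m, n, rfl⟩ := exists_eq_omega_pow_mul hb h
  exact isNormValue_omega_pow_mul j k m n

end Gaussian

theorem isNormValue_of_norm_lt [hε : Fact (ε ^ 2 < 4)] {a b : ZOmega ε} (ha : a ≠ 0)
    (hb : Squarefree b) (hab : norm a ≤ norm b) (h : norm b < 5 - 2 * ε ^ 2) :
    IsNormValue a b := by
  rcases sq_eq_zero_or_sq_eq_one (ε := ε) with he | he
  · obtain rfl : ε = 0 := by simpa using he
    exact isNormValue_of_norm_le_two ha hb.ne_zero hab (norm_le_two_of_squarefree hb (by lia))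
  · exact isNormValue_of_norm_le_two_of_sq_eq_one he ha hab (by lia)

theorem isNormValue_of_forall_tameSplit [Fact (ε ^ 2 < 4)] {a b : ZOmega ε} (ha : a ≠ 0)
    (hb : b ≠ 0) (h : ∀ π, Prime π → TameSplit π a b) : IsNormValue a b := by
  refine QuatAlg.isNormValue_of_forall_tameSplit (natNorm ε) (fun _ => isUnit_of_natNorm_eq_one)
    (fun _ => not_imp_not.mp natNorm_ne_zero) two_ne_zero (fun a b ha hb hab hmod => ?_) ha hb h
  zify [natNorm_cast] at hab ⊢
  obtain ⟨t, c, htc, ht⟩ := exists_sq_eq_add_mul hb.ne_zero hmod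
  rcases lt_or_ge (norm b) (5 - 2 * ε ^ 2) with hsmall | hlarge
  · exact .inl (isNormValue_of_norm_lt ha hb hab hsmall)
  · exact .inr ⟨t, c, htc, norm_lt_of_sq_eq_add_mul htc hab ht hlarge⟩

end ZOmega

/-! ### Quaternions of norm one and given trace -/

section Embedding

variable {F : Type*} [Field F] {a b : F}

theorem reducedTrace_eq (x : Quat F a b) : reducedTrace x = 2 * x.re := by
  simp [reducedTrace, two_mul]

theorem reducedNorm_eq (x : Quat F a b) :
    reducedNorm x = x.re ^ 2 - a * x.imI ^ 2 - b * x.imJ ^ 2 + a * b * x.imK ^ 2 := by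
  simp only [reducedNorm, QuaternionAlgebra.re_mul, QuaternionAlgebra.re_star,
    QuaternionAlgebra.imI_star, QuaternionAlgebra.imJ_star, QuaternionAlgebra.imK_star]
  ring

theorem reducedNorm_mul (x y : Quat F a b) :
    reducedNorm (x * y) = reducedNorm x * reducedNorm y := by
  simp only [reducedNorm_eq, QuaternionAlgebra.re_mul, QuaternionAlgebra.imI_mul,
    QuaternionAlgebra.imJ_mul, QuaternionAlgebra.imK_mul]
  ring

theorem reducedNorm_star (x : Quat F a b) : reducedNorm (star x) = reducedNorm x := by
  simp [reducedNorm_eq]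

theorem reducedNorm_smul (c : F) (x : Quat F a b) :
    reducedNorm (c • x) = c ^ 2 * reducedNorm x := by
  simp only [reducedNorm_eq, QuaternionAlgebra.re_smul, QuaternionAlgebra.imI_smul,
    QuaternionAlgebra.imJ_smul, QuaternionAlgebra.imK_smul, smul_eq_mul]
  ring

theorem exists_trace_norm_of_isotropic (h2 : (2 : F) ≠ 0) (ha : a ≠ 0)
    {v : Quat F a b} (hre : v.re = 0) (himI : v.imI ≠ 0) (hv : reducedNorm v = 0) (t n : F) :
    ∃ x : Quat F a b, reducedTrace x = t ∧ reducedNorm x = n := by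
  -- On the line through `t / 2 + i` in the direction of `v`, the reduced norm is affine.
  obtain ⟨α, hα⟩ : ∃ α, (t / 2) ^ 2 - a * (1 + 2 * α * v.imI) = n :=
    ⟨(((t / 2) ^ 2 - n) / a - 1) / (2 * v.imI), by field_simp; ring⟩
  refine ⟨⟨t / 2, 1 + α * v.imI, α * v.imJ, α * v.imK⟩, ?_, ?_⟩
  · rw [reducedTrace_eq]
    field_simp
  · rw [reducedNorm_eq, hre] at hv
    rw [reducedNorm_eq]
    linear_combination hα + α ^ 2 * hv

theorem exists_trace_norm_one_of_reducedTrace_mul_star {v w : Quat F a b}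
    {t : F} (hw : reducedNorm w ≠ 0) (hvw : reducedNorm v = reducedNorm w)
    (htr : reducedTrace (v * star w) = t * reducedNorm w) :
    ∃ x : Quat F a b, reducedTrace x = t ∧ reducedNorm x = 1 := by
  refine ⟨(reducedNorm w)⁻¹ • (v * star w), ?_, ?_⟩
  · rw [reducedTrace_eq] at htr ⊢
    rw [QuaternionAlgebra.re_smul, smul_eq_mul]
    field_simp
    linear_combination htr
  · rw [reducedNorm_smul, reducedNorm_mul, reducedNorm_star, hvw]
    field_simp

theorem exists_trace_norm_of_mul_sq {c d t n : F} :
    (∃ x : Quat F (a * c ^ 2) (b * d ^ 2), reducedTrace x = t ∧ reducedNorm x = n) →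
      ∃ x : Quat F a b, reducedTrace x = t ∧ reducedNorm x = n := by
  rintro ⟨x, htr, hnorm⟩
  rw [reducedTrace_eq] at htr
  rw [reducedNorm_eq] at hnorm
  refine ⟨⟨x.re, c * x.imI, d * x.imJ, c * d * x.imK⟩, by rwa [reducedTrace_eq], ?_⟩
  rw [reducedNorm_eq]
  linear_combination hnorm

theorem exists_trace_norm_one_of_isNormValue {ε A B : ℤ} (hA : A ≠ 0)
    (hB : B ≠ 0) (h : IsNormValue (A : ZOmega ε) B) :
    ∃ x : Quat ℚ A B, reducedTrace x = ε ∧ reducedNorm x = 1 := by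
  obtain ⟨x, y, z, hz, h⟩ := h
  have hre := congrArg (fun r : ZOmega ε => (r.re : ℚ)) h
  have him := congrArg (fun r : ZOmega ε => (r.im : ℚ)) h
  simp only [pow_two, QuadraticAlgebra.re_mul, QuadraticAlgebra.re_sub, QuadraticAlgebra.im_mul,
    QuadraticAlgebra.im_sub, QuadraticAlgebra.re_intCast, QuadraticAlgebra.im_intCast, Int.cast_eq,
    zero_mul, mul_zero, add_zero] at hre him
  push_cast at hre him
  have hA' : (A : ℚ) ≠ 0 := by exact_mod_cast hA
  -- The equation says that `v - ω • w` has reduced norm `0` over `ℚ(ω)`.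
  let v : Quat ℚ A B := ⟨0, B * z.re, A * y.re, x.re⟩
  let w : Quat ℚ A B := ⟨0, -(B * z.im), -(A * y.im), -x.im⟩
  have hvw : reducedNorm v = reducedNorm w := by
    simp only [reducedNorm_eq, v, w]
    linear_combination -A * B * hre
  have htr : reducedTrace (v * star w) = ε * reducedNorm w := by
    simp only [reducedNorm_eq, reducedTrace_eq, v, w, QuaternionAlgebra.star_mk,
      QuaternionAlgebra.mk_mul_mk]
    linear_combination A * B * him
  by_cases hw : reducedNorm w = 0
  · by_cases hz' : z.im = 0
    · have : z.re ≠ 0 := fun h0 => hz (by ext <;> simp [h0, hz'])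
      exact exists_trace_norm_of_isotropic two_ne_zero hA' (v := v) rfl (by simp [v, hB, this])
        (hvw.trans hw) _ _
    · exact exists_trace_norm_of_isotropic two_ne_zero hA' (v := w) rfl (by simp [w, hB, hz'])
        hw _ _
  · exact exists_trace_norm_one_of_reducedTrace_mul_star hw hvw htr

end Embedding

/-! ### Splitting and norm values -/

section Split

open Matrix

variable {K : Type*} [Field K]

theorem IsNormValue.of_matrix (h2 : (2 : K) ≠ 0) {a b : K} (ha : a ≠ 0)
    {I J : Matrix (Fin 2) (Fin 2) K} (hI : I * I = a • 1) (hJ : J * J = b • 1)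
    (hIJ : J * I = -(I * J)) : IsNormValue a b := by
  have hI₀ := congrFun₂ hI 0 0
  have hJ₀ := congrFun₂ hJ 0 0
  have hIJ₀ := congrFun₂ hIJ 0 0
  simp only [mul_apply, Fin.sum_univ_two, Matrix.smul_apply, Matrix.neg_apply, smul_eq_mul,
    one_apply_eq, mul_one] at hI₀ hJ₀ hIJ₀
  by_cases hr : I 1 0 = 0
  · refine .of_isSquare_left h2 ha ⟨I 0 0, ?_⟩ b
    rw [hr] at hI₀
    linear_combination -hI₀
  · refine ⟨J 0 0 * I 1 0 - J 1 0 * I 0 0, J 1 0, I 1 0, hr, ?_⟩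
    linear_combination (-I 1 0 ^ 2) * hJ₀ - J 1 0 ^ 2 * hI₀ + I 1 0 * J 1 0 * hIJ₀

variable {F : Type*} [Field F] [Algebra F K] {a b : F}

theorem SplitOver.isNormValue (h2 : (2 : K) ≠ 0) (ha : a ≠ 0) (h : SplitOver a b K) :
    IsNormValue (algebraMap F K a) (algebraMap F K b) := by
  obtain ⟨e⟩ := h
  let f : Quat F a b →ₐ[F] Matrix (Fin 2) (Fin 2) K :=
    (e.toAlgHom.restrictScalars F).comp Algebra.TensorProduct.includeRight
  let q := (QuaternionAlgebra.Basis.self F (c₁ := a) (c₂ := 0) (c₃ := b)).compHom f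
  refine .of_matrix h2 (by simpa using ha) (I := q.i) (J := q.j) ?_ ?_ ?_
  · rw [q.i_mul_i]; simp
  · rw [q.j_mul_j]; simp
  · rw [q.j_mul_i, q.i_mul_j]; simp

/-- The matrices representing `i`, `j` and `k` when `b` is of the form `x ^ 2 - a * y ^ 2`: `i` acts
on `K[i]` by multiplication and `j` by conjugation followed by multiplication with `x + y * i`. -/
def matrixBasis {x y : K} (h : algebraMap F K b = x ^ 2 - algebraMap F K a * y ^ 2) :
    QuaternionAlgebra.Basis (Matrix (Fin 2) (Fin 2) K) a 0 b where
  i := !![0, algebraMap F K a; 1, 0]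
  j := !![x, -(algebraMap F K a * y); y, -x]
  k := !![algebraMap F K a * y, -(algebraMap F K a * x); x, -(algebraMap F K a * y)]
  i_mul_i := by
    ext i j
    fin_cases i <;> fin_cases j <;> simp [mul_apply, Algebra.algebraMap_eq_smul_one]
  j_mul_j := by
    rw [← algebraMap_smul K b, h]
    ext i j
    fin_cases i <;> fin_cases j <;> simp [mul_apply] <;> ring
  i_mul_j := by
    ext i j
    fin_cases i <;> fin_cases j <;> simp [mul_apply]
  j_mul_i := by
    ext i j
    fin_cases i <;> fin_cases j <;> simp [mul_apply] <;> ring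

theorem exists_eq_smul_matrixBasis (h2 : (2 : K) ≠ 0) (ha : a ≠ 0) (hb : b ≠ 0) {x y : K}
    (h : algebraMap F K b = x ^ 2 - algebraMap F K a * y ^ 2) (M : Matrix (Fin 2) (Fin 2) K) :
    ∃ s t u v : K, M = s • 1 + t • (matrixBasis h).i + u • (matrixBasis h).j +
      v • (matrixBasis h).k := by
  have ha' : algebraMap F K a ≠ 0 := by simpa using ha
  have hb' : algebraMap F K b ≠ 0 := by simpa using hb
  -- Distinct elements of `1, i, j, k` are orthogonal for the trace form.
  refine ⟨M.trace / 2, (M * (matrixBasis h).i).trace / (2 * algebraMap F K a),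
    (M * (matrixBasis h).j).trace / (2 * algebraMap F K b),
    -(M * (matrixBasis h).k).trace / (2 * algebraMap F K a * algebraMap F K b), ?_⟩
  ext m n
  fin_cases m <;> fin_cases n <;>
    simp [matrixBasis, trace_fin_two, mul_apply] <;> field_simp <;> simp only [h] <;> ring

theorem splitOver_of_isNormValue (h2 : (2 : K) ≠ 0) (ha : a ≠ 0) (hb : b ≠ 0)
    (h : IsNormValue (algebraMap F K a) (algebraMap F K b)) : SplitOver a b K := by
  obtain ⟨x, y, h⟩ := isNormValue_iff_exists_eq_sq_sub.mp h
  let φ : K ⊗[F] Quat F a b →ₐ[K] Matrix (Fin 2) (Fin 2) K :=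
    Algebra.TensorProduct.lift (Algebra.ofId K _) (matrixBasis h).liftHom
      (fun r _ => Algebra.commutes r _)
  have hφ (c : K) (z : Quat F a b) : φ (c ⊗ₜ z) = c • (matrixBasis h).lift z := by
    rw [Algebra.smul_def]
    rfl
  have hsurj : Function.Surjective φ := by
    intro M
    obtain ⟨s, t, u, v, rfl⟩ := exists_eq_smul_matrixBasis h2 ha hb h M
    refine ⟨s ⊗ₜ 1 + t ⊗ₜ ⟨0, 1, 0, 0⟩ + u ⊗ₜ ⟨0, 0, 1, 0⟩ + v ⊗ₜ ⟨0, 0, 0, 1⟩, ?_⟩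
    simp only [map_add, hφ, QuaternionAlgebra.Basis.lift]
    simp
  have hrank : Module.finrank K (K ⊗[F] Quat F a b)
      = Module.finrank K (Matrix (Fin 2) (Fin 2) K) := by
    rw [Module.finrank_baseChange, QuaternionAlgebra.finrank_eq_four, Module.finrank_matrix]
    simp
  have hinj : Function.Injective φ :=
    (LinearMap.injective_iff_surjective_of_finrank_eq_finrank (f := φ.toLinearMap) hrank).mpr hsurj
  exact ⟨AlgEquiv.ofBijective φ ⟨hinj, hsurj⟩⟩

end Split

/-! ### Local conditions -/

section Local

theorem isSquare_mul_of_not_isSquare {F : Type*} [Field F] [Finite F] {c d : F}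
    (hc : ¬ IsSquare c) (hd : ¬ IsSquare d) : IsSquare (c * d) := by
  have := Fintype.ofFinite F
  classical
  have hc0 : c ≠ 0 := by rintro rfl; exact hc IsSquare.zero
  have hd0 : d ≠ 0 := by rintro rfl; exact hd IsSquare.zero
  rw [← quadraticChar_one_iff_isSquare (mul_ne_zero hc0 hd0), map_mul,
    quadraticChar_neg_one_iff_not_isSquare.mpr hc, quadraticChar_neg_one_iff_not_isSquare.mpr hd]
  norm_num

theorem TameSplit.map_pow_mul {R S : Type*} [CommRing R] [CommRing S] (f : R →+* S) {p : R}
    {π w : S} {e : ℕ} (hπ : Prime π) (hp : f p = π ^ e * w) (hw : ¬ π ∣ w) {m n : ℕ} {a b : R}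
    (ha : ¬ π ∣ f a) (hb : ¬ π ∣ f b)
    (h : IsSquareMod π (f ((-1) ^ (m * n) * a ^ n * b ^ m) ^ e)) :
    TameSplit π (f (p ^ m * a)) (f (p ^ n * b)) := by
  have hwpow (k : ℕ) : ¬ π ∣ w ^ k := mt hπ.dvd_of_dvd_pow hw
  refine ⟨e * m, e * n, w ^ m * f a, w ^ n * f b, ?_, ?_, hπ.not_dvd_mul (hwpow m) ha,
    hπ.not_dvd_mul (hwpow n) hb, ?_⟩
  · rw [map_mul, map_pow, hp]
    ring
  · rw [map_mul, map_pow, hp]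
    ring
  · convert h.mul (.of_isSquare (.sq (w ^ (e * m * n)))) using 1
    rw [neg_one_pow_congr (n := m * n * e) (by simp only [Nat.even_mul]; tauto)]
    simp only [map_mul, map_pow, map_neg, map_one]
    ring

variable {R : Type*} [CommRing R] {π : R}

theorem exists_prime_dvd_natCast (hπ : Prime π) {n : ℕ} (hn : n ≠ 0) (h : π ∣ (n : R)) :
    ∃ p : ℕ, p.Prime ∧ π ∣ (p : R) := by
  induction n using induction_on_primes with
  | zero => exact absurd rfl hn
  | one => exact absurd (isUnit_of_dvd_one (by simpa using h)) hπ.not_isUnit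
  | prime_mul p a hp ih =>
    rw [Nat.cast_mul] at h
    exact (hπ.dvd_or_dvd h).elim (fun hd => ⟨p, hp, hd⟩) (ih (right_ne_zero_of_mul hn))

theorem isSquareMod_intCast {p : ℕ} (hπp : π ∣ (p : R)) {c : ℤ} (hc : IsSquare (c : ZMod p)) :
    IsSquareMod π (c : R) := by
  obtain ⟨y, hy⟩ := hc
  obtain ⟨x, rfl⟩ := ZMod.intCast_surjective y
  obtain ⟨k, hk⟩ := (ZMod.intCast_eq_intCast_iff_dvd_sub c (x * x) p).mp (by push_cast; exact hy)
  refine isSquareMod_iff_exists_dvd_sq_sub.mpr ⟨x, ?_⟩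
  convert hπp.mul_right (k : R) using 1
  simpa [pow_two] using congrArg (Int.cast : ℤ → R) hk

variable {p : ℕ} [hp : Fact p.Prime]

theorem not_dvd_intCast_of_not_dvd (hπ : Prime π) (hπp : π ∣ (p : R)) {c : ℤ}
    (hc : ¬ (p : ℤ) ∣ c) : ¬ π ∣ (c : R) := fun hdvd => by
  have hcop : IsCoprime (c : R) (p : R) := by
    simpa using (((Nat.prime_iff_prime_int.mp hp.out).coprime_iff_not_dvd.mpr hc).symm.map
      (Int.castRingHom R))
  exact hπ.not_isUnit (hcop.isUnit_of_dvd' hdvd hπp)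

theorem isSquare_zmod_of_isNormValue_padic {m n : ℕ} {a b : ℤ} (ha : ¬ (p : ℤ) ∣ a)
    (hb : ¬ (p : ℤ) ∣ b)
    (h : IsNormValue ((p ^ m * a : ℤ) : ℚ_[p]) ((p ^ n * b : ℤ) : ℚ_[p])) :
    IsSquare (((-1) ^ (m * n) * a ^ n * b ^ m : ℤ) : ZMod p) := by
  have hnot {c : ℤ} (hc : ¬ (p : ℤ) ∣ c) : ¬ (p : ℤ_[p]) ∣ c :=
    not_dvd_intCast_of_not_dvd PadicInt.prime_p dvd_rfl hc
  have hp0 : (p : ℤ_[p]) ≠ 0 := PadicInt.prime_p.ne_zero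
  have hne {k : ℕ} {c : ℤ} (hc : ¬ (p : ℤ) ∣ c) : (p : ℤ_[p]) ^ k * c ≠ 0 :=
    mul_ne_zero (pow_ne_zero k hp0) fun h0 => hnot hc (h0 ▸ dvd_zero _)
  have hZ : IsNormValue ((p : ℤ_[p]) ^ m * a) ((p : ℤ_[p]) ^ n * b) :=
    .of_map_algebraMap (K := ℚ_[p]) (by simpa using h)
  obtain ⟨x, hx⟩ := isSquareMod_iff_exists_dvd_sq_sub.mp <|
    (tameSplit_pow_mul_iff PadicInt.prime_p (hnot ha) (hnot hb)).mp
      (hZ.tameSplit PadicInt.prime_p (hne ha) (hne hb))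
  have := map_dvd (PadicInt.toZMod (p := p)) hx
  refine ⟨PadicInt.toZMod x, ?_⟩
  rw [map_natCast, ZMod.natCast_self, zero_dvd_iff, map_sub, sub_eq_zero] at this
  simpa [pow_two] using this.symm

theorem isSquare_padic_of_isSquare_zmod (hp2 : p ≠ 2) {c : ℤ} (hpc : ¬ (p : ℤ) ∣ c)
    (hc : IsSquare (c : ZMod p)) : IsSquare (c : ℚ_[p]) := by
  obtain ⟨y, hy⟩ := hc
  obtain ⟨r, rfl⟩ := ZMod.intCast_surjective y
  have hdvd : (p : ℤ) ∣ r ^ 2 - c :=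
    (ZMod.intCast_eq_intCast_iff_dvd_sub c (r ^ 2) p).mp (by push_cast; rw [hy, pow_two])
  have hprime : Prime (p : ℤ) := Nat.prime_iff_prime_int.mp hp.out
  have hp2' : ¬ (p : ℤ) ∣ 2 := by
    exact_mod_cast mt (Nat.prime_dvd_prime_iff_eq hp.out Nat.prime_two).mp hp2
  have hr : ¬ (p : ℤ) ∣ r := fun h => hpc ((dvd_sub_right (h.pow two_ne_zero)).mp hdvd)
  have hderiv : ‖((2 * r : ℤ) : ℤ_[p])‖ = 1 :=
    (PadicInt.norm_le_one _).eq_of_not_lt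
      ((PadicInt.norm_int_lt_one_iff_dvd _).not.mpr (hprime.not_dvd_mul hp2' hr))
  obtain ⟨w, hw, -⟩ := hensels_lemma (p := p) (R := ℤ_[p])
    (F := Polynomial.X ^ 2 - Polynomial.C (c : ℤ_[p])) (a := (r : ℤ_[p])) (by
      have := (PadicInt.norm_int_lt_one_iff_dvd _).mpr hdvd
      push_cast at this hderiv
      simpa [Polynomial.aeval_def, one_add_one_eq_two, ← two_mul, hderiv] using this)
  have hw' : w ^ 2 = c := sub_eq_zero.mp (by simpa using hw)
  exact ⟨w, by rw [← pow_two]; exact_mod_cast congrArg ((↑) : ℤ_[p] → ℚ_[p]) hw'.symm⟩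

end Local

section Criterion

open QuadraticAlgebra

/-- The odd prime `p` splits in `ℤ[ω]`, that is, the discriminant `ε ^ 2 - 4` is a nonzero square
modulo `p`. The prime `2` is left out, as it is ramified or inert for `ε = 0, 1, -1`. -/
def IsSplitPrime (ε : ℤ) (p : ℕ) : Prop :=
  p ≠ 2 ∧ ¬ (p : ℤ) ∣ ε ^ 2 - 4 ∧ IsSquare ((ε ^ 2 - 4 : ℤ) : ZMod p)

variable {ε : ℤ}

namespace ZOmega

theorem sq_two_mul_omega_sub : (2 * ω - (ε : ZOmega ε)) ^ 2 = ((ε ^ 2 - 4 : ℤ) : ZOmega ε) := by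
  push_cast
  linear_combination 4 * omega_sq (ε := ε)

variable [hε : Fact (ε ^ 2 < 4)] {π w : ZOmega ε} {p : ℕ} [hp : Fact p.Prime]

theorem exists_prime_nat_dvd (hπ : Prime π) : ∃ p : ℕ, p.Prime ∧ π ∣ (p : ZOmega ε) := by
  refine exists_prime_dvd_natCast hπ (natNorm_ne_zero hπ.ne_zero) ⟨star π, ?_⟩
  rw [← algebraMap_norm_eq_mul_star, ← natNorm_cast]
  simp

theorem even_of_dvd_discr (hπ : Prime π) (hp2 : p ≠ 2) (hdvd : (p : ℤ) ∣ ε ^ 2 - 4) {e : ℕ}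
    (hpe : (p : ZOmega ε) = π ^ e * w) (hw : ¬ π ∣ w) : Even e := by
  have hp2' : ¬ p ∣ 2 := mt (Nat.prime_dvd_prime_iff_eq hp.out Nat.prime_two).mp hp2
  have hε1 : ε ^ 2 = 1 := (sq_eq_zero_or_sq_eq_one (hε := hε)).resolve_left fun h => by
    rw [h, zero_sub, dvd_neg] at hdvd
    exact hp2' (hp.out.dvd_of_dvd_pow (n := 2) (by exact_mod_cast hdvd))
  have hp3 : p = 3 := by
    rw [hε1] at hdvd
    exact (Nat.prime_dvd_prime_iff_eq hp.out Nat.prime_three).mp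
      (Int.natCast_dvd_natCast.mp (dvd_neg.mp hdvd))
  have hθ : (p : ZOmega ε) = -(2 * ω - (ε : ZOmega ε)) ^ 2 := by
    rw [sq_two_mul_omega_sub, hε1, hp3]
    norm_num
  have hθ0 : 2 * ω - (ε : ZOmega ε) ≠ 0 := fun h0 => by
    rw [h0, hp3] at hθ
    norm_num at hθ
  obtain ⟨k, u, hu, hk⟩ := WfDvdMonoid.max_power_factor hθ0 hπ.irreducible
  have := (eq_and_eq_of_pow_mul_eq_pow_mul hπ (m := e) (n := 2 * k) (a := w) (b := -u ^ 2) hw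
    (by rw [dvd_neg]; exact mt hπ.dvd_of_dvd_pow hu) (by rw [← hpe, hθ, hk]; ring)).1
  exact this ▸ even_two_mul k

theorem isSquareMod_intCast_of_not_isSquare_discr (hπ : Prime π) (hπp : π ∣ (p : ZOmega ε))
    (hdvd : ¬ (p : ℤ) ∣ ε ^ 2 - 4) (hsq : ¬ IsSquare ((ε ^ 2 - 4 : ℤ) : ZMod p)) (c : ℤ) :
    IsSquareMod π (c : ZOmega ε) := by
  by_cases hc : IsSquare (c : ZMod p)
  · exact isSquareMod_intCast hπp hc
  · refine .of_mul_right hπ (not_dvd_intCast_of_not_dvd hπ hπp hdvd)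
      (sq_two_mul_omega_sub (ε := ε) ▸ .of_isSquare (.sq _)) ?_
    rw [← Int.cast_mul]
    exact isSquareMod_intCast hπp (Int.cast_mul (α := ZMod p) _ c ▸
      isSquare_mul_of_not_isSquare hsq hc)

theorem isSquareMod_intCast_pow (hπ : Prime π) (hsplit : ¬ IsSplitPrime ε p) {e : ℕ}
    (hpe : (p : ZOmega ε) = π ^ e * w) (hw : ¬ π ∣ w) (he : e ≠ 0) (c : ℤ) :
    IsSquareMod π ((c : ZOmega ε) ^ e) := by
  have hπp : π ∣ (p : ZOmega ε) := hpe ▸ (dvd_pow_self π he).mul_right w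
  rcases eq_or_ne p 2 with rfl | hp2
  · have hc : IsSquare (c : ZMod 2) := FiniteField.isSquare_of_char_two (ZMod.ringChar_zmod_n 2) _
    exact (isSquareMod_intCast hπp hc).pow e
  by_cases hdvd : (p : ℤ) ∣ ε ^ 2 - 4
  · exact .of_isSquare ((even_of_dvd_discr hπ hp2 hdvd hpe hw).isSquare_pow _)
  · have hsq := fun h => hsplit ⟨hp2, hdvd, h⟩
    exact (isSquareMod_intCast_of_not_isSquare_discr hπ hπp hdvd hsq c).pow e

theorem tameSplit_intCast (hπ : Prime π) (hπp : π ∣ (p : ZOmega ε)) {a b : ℤ} (ha : a ≠ 0)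
    (hb : b ≠ 0) (h : IsSplitPrime ε p → IsNormValue (a : ℚ_[p]) b) :
    TameSplit π (a : ZOmega ε) b := by
  have hprime : Prime (p : ℤ) := Nat.prime_iff_prime_int.mp hp.out
  obtain ⟨m, a', ha', rfl⟩ := WfDvdMonoid.max_power_factor ha hprime.irreducible
  obtain ⟨n, b', hb', rfl⟩ := WfDvdMonoid.max_power_factor hb hprime.irreducible
  have hp0 : (p : ZOmega ε) ≠ 0 := Nat.cast_ne_zero.mpr hp.out.ne_zero
  obtain ⟨e, w, hw, hpe⟩ := WfDvdMonoid.max_power_factor hp0 hπ.irreducible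
  have he : e ≠ 0 := by
    rintro rfl
    exact hw (by simpa [hpe] using hπp)
  refine .map_pow_mul (Int.castRingHom _) hπ (by rwa [map_natCast]) hw
    (not_dvd_intCast_of_not_dvd hπ hπp ha') (not_dvd_intCast_of_not_dvd hπ hπp hb') ?_
  by_cases hsplit : IsSplitPrime ε p
  · exact (isSquareMod_intCast hπp (isSquare_zmod_of_isNormValue_padic ha' hb' (h hsplit))).pow e
  · exact isSquareMod_intCast_pow hπ hsplit hpe hw he _

theorem isNormValue_intCast {a b : ℤ} (ha : a ≠ 0) (hb : b ≠ 0)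
    (h : ∀ (p : ℕ) [Fact p.Prime], IsSplitPrime ε p → IsNormValue (a : ℚ_[p]) b) :
    IsNormValue (a : ZOmega ε) b := by
  refine isNormValue_of_forall_tameSplit (Int.cast_ne_zero.mpr ha) (Int.cast_ne_zero.mpr hb) ?_
  intro π hπ
  obtain ⟨p, hp, hπp⟩ := exists_prime_nat_dvd hπ
  have : Fact p.Prime := ⟨hp⟩
  exact tameSplit_intCast hπ hπp ha hb (h p)

end ZOmega

theorem splitOver_padic_of_exists_trace_norm {a b : ℚ} (ha : a ≠ 0) (hb : b ≠ 0)
    (h : ∃ x : Quat ℚ a b, reducedTrace x = ε ∧ reducedNorm x = 1) {p : ℕ} [hp : Fact p.Prime]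
    (hp : IsSplitPrime ε p) : SplitOver a b ℚ_[p] := by
  obtain ⟨x, htr, hnorm⟩ := h
  obtain ⟨hp2, hdvd, hsq⟩ := hp
  obtain ⟨s, hs⟩ := isSquare_padic_of_isSquare_zmod hp2 hdvd hsq
  have hs0 : s ≠ 0 := by
    rintro rfl
    exact hdvd (by rw [Int.cast_eq_zero.mp (hs.trans (mul_zero 0))]; exact dvd_zero _)
  rw [reducedTrace_eq] at htr
  rw [reducedNorm_eq] at hnorm
  have hpure : a * (2 * x.imI) ^ 2 + b * (2 * x.imJ) ^ 2 - a * b * (2 * x.imK) ^ 2 =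
      ((ε ^ 2 - 4 : ℤ) : ℚ) := by
    push_cast
    linear_combination (2 * x.re + ε) * htr - 4 * hnorm
  refine splitOver_of_isNormValue two_ne_zero ha hb
    (.of_pure_eq_sq two_ne_zero (by simpa using ha) hs0 (x := ((2 * x.imI : ℚ) : ℚ_[p]))
      (y := ((2 * x.imJ : ℚ) : ℚ_[p])) (z := ((2 * x.imK : ℚ) : ℚ_[p])) ?_)
  rw [pow_two s, ← hs]
  simp only [eq_ratCast]
  exact_mod_cast congrArg (Rat.cast : ℚ → ℚ_[p]) hpure

theorem exists_mul_sq_eq_intCast {a : ℚ} (ha : a ≠ 0) :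
    ∃ (d : ℚ) (A : ℤ), d ≠ 0 ∧ A ≠ 0 ∧ a * d ^ 2 = A := by
  refine ⟨a.den, a.num * a.den, by simp, by simp [ha], ?_⟩
  rw [pow_two, ← mul_assoc, Rat.mul_den_eq_num]
  push_cast
  rfl

theorem exists_trace_norm_one_iff [Fact (ε ^ 2 < 4)] {a b : ℚ} (ha : a ≠ 0) (hb : b ≠ 0) :
    (∃ x : Quat ℚ a b, reducedTrace x = ε ∧ reducedNorm x = 1) ↔
      ∀ (p : ℕ) [Fact p.Prime], IsSplitPrime ε p → SplitOver a b ℚ_[p] := by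
  refine ⟨fun h p _ => splitOver_padic_of_exists_trace_norm ha hb h, fun h => ?_⟩
  obtain ⟨c, A, hc, hA, hcA⟩ := exists_mul_sq_eq_intCast ha
  obtain ⟨d, B, -, hB, hdB⟩ := exists_mul_sq_eq_intCast hb
  refine exists_trace_norm_of_mul_sq (c := c) (d := d) ?_
  rw [hcA, hdB]
  refine exists_trace_norm_one_of_isNormValue hA hB
    (ZOmega.isNormValue_intCast hA hB fun p _ hp => ?_)
  have hab := (h p hp).isNormValue two_ne_zero ha
  convert hab.mul_sq_mul_sq (c := (c : ℚ_[p])) (d := (d : ℚ_[p])) (by exact_mod_cast hc) using 1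
  · simpa using congrArg (algebraMap ℚ ℚ_[p]) hcA.symm
  · simpa using congrArg (algebraMap ℚ ℚ_[p]) hdB.symm

theorem exists_trace_norm_one_iff_of_hasDiscriminant [Fact (ε ^ 2 < 4)] {a b : ℚ} (ha : a ≠ 0)
    (hb : b ≠ 0) {N : ℕ} (hN : HasDiscriminant a b N) :
    (∃ x : Quat ℚ a b, reducedTrace x = ε ∧ reducedNorm x = 1) ↔
      ¬ ∃ p : ℕ, p.Prime ∧ p ∣ N ∧ IsSplitPrime ε p := by
  rw [exists_trace_norm_one_iff ha hb]
  constructor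
  · rintro h ⟨p, hp, hpN, hsplit⟩
    have : Fact p.Prime := ⟨hp⟩
    exact (hN p).mpr hpN (h p hsplit)
  · intro h p hp hsplit
    by_contra hram
    exact h ⟨p, hp.out, (hN p).mp hram, hsplit⟩

theorem isSplitPrime_zero_iff {p : ℕ} (hp : p.Prime) : IsSplitPrime 0 p ↔ p ≡ 1 [MOD 4] := by
  have := Fact.mk hp
  have hdvd (hp2 : p ≠ 2) : ¬ (p : ℤ) ∣ 0 ^ 2 - 4 := fun h => by
    have h4 : p ∣ 2 ^ 2 := Int.natCast_dvd_natCast.mp (dvd_neg.mp h)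
    exact hp2 ((Nat.prime_dvd_prime_iff_eq hp Nat.prime_two).mp (hp.dvd_of_dvd_pow h4))
  have h2 (hp2 : p ≠ 2) : (2 : ZMod p) ≠ 0 := Ring.two_ne_zero (by rwa [ZMod.ringChar_zmod_n])
  have hmod : p ≠ 2 ∧ p % 4 ≠ 3 ↔ p ≡ 1 [MOD 4] := by
    have := hp.eq_two_or_odd
    grind [Nat.ModEq]
  rw [← hmod, ← ZMod.exists_sq_eq_neg_one_iff]
  refine ⟨fun ⟨hp2, _, s, hs⟩ => ⟨hp2, s / 2, ?_⟩, fun ⟨hp2, i, hi⟩ => ⟨hp2, hdvd hp2, 2 * i, ?_⟩⟩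
  · have := h2 hp2
    push_cast at hs
    field_simp
    linear_combination hs
  · push_cast
    linear_combination 4 * hi

theorem exists_sq_add_self_add_one_eq_zero_iff {p : ℕ} [hp : Fact p.Prime] (hp3 : p ≠ 3) :
    (∃ ζ : ZMod p, ζ ^ 2 + ζ + 1 = 0) ↔ p ≡ 1 [MOD 3] := by
  have hdvd : p ≡ 1 [MOD 3] ↔ 3 ∣ p - 1 :=
    Nat.ModEq.comm.trans (Nat.modEq_iff_dvd' hp.out.one_le)
  rw [hdvd]
  constructor
  · rintro ⟨ζ, hζ⟩
    have hζ1 : ζ ≠ 1 := by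
      rintro rfl
      have h3 : p ∣ 3 := (ZMod.natCast_eq_zero_iff 3 p).mp (by push_cast; linear_combination hζ)
      exact hp3 ((Nat.prime_dvd_prime_iff_eq hp.out Nat.prime_three).mp h3)
    have hζ0 : ζ ≠ 0 := by
      rintro rfl
      simp at hζ
    have := orderOf_eq_prime (p := 3) (by linear_combination (ζ - 1) * hζ) hζ1
    exact this ▸ ZMod.orderOf_dvd_card_sub_one hζ0
  · intro h
    obtain ⟨u, hu⟩ := exists_prime_orderOf_dvd_card (G := (ZMod p)ˣ) 3
      (by rwa [ZMod.card_units])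
    have hu3 : (u : ZMod p) ^ 3 = 1 := by
      rw [← Units.val_pow_eq_pow_val, ← hu, pow_orderOf_eq_one, Units.val_one]
    have hu1 : (u : ZMod p) - 1 ≠ 0 := fun h0 => by
      rw [orderOf_eq_one_iff.mpr (Units.ext (sub_eq_zero.mp h0))] at hu
      norm_num at hu
    exact ⟨u, mul_left_cancel₀ hu1 (by linear_combination hu3)⟩

theorem isSplitPrime_one_iff {p : ℕ} (hp : p.Prime) : IsSplitPrime 1 p ↔ p ≡ 1 [MOD 3] := by
  have := Fact.mk hp
  have hdvd : (p : ℤ) ∣ 1 ^ 2 - 4 ↔ p = 3 := by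
    rw [← Nat.prime_dvd_prime_iff_eq hp Nat.prime_three, ← Int.natCast_dvd_natCast, ← dvd_neg]
    norm_num
  have h2 (hp2 : p ≠ 2) : (2 : ZMod p) ≠ 0 := Ring.two_ne_zero (by rwa [ZMod.ringChar_zmod_n])
  constructor
  · rintro ⟨hp2, hp3, s, hs⟩
    refine (exists_sq_add_self_add_one_eq_zero_iff (mt hdvd.mpr hp3)).mp ⟨(s - 1) / 2, ?_⟩
    have := h2 hp2
    push_cast at hs
    field_simp
    linear_combination -hs
  · intro h
    have hp3 : p ≠ 3 := by rintro rfl; exact absurd h (by decide)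
    obtain ⟨ζ, hζ⟩ := (exists_sq_add_self_add_one_eq_zero_iff hp3).mpr h
    refine ⟨by rintro rfl; exact absurd h (by decide), mt hdvd.mp hp3, 2 * ζ + 1, ?_⟩
    push_cast
    linear_combination -4 * hζ

end Criterion

end QuatAlg

theorem mainTheorem7_general (a b : ℚ) (ha : a ≠ 0) (hb : b ≠ 0) (N : ℕ)
    (hdisc : QuatAlg.HasDiscriminant a b N) :
    ((∃ x : QuatAlg.Quat ℚ a b, QuatAlg.reducedTrace x = 0 ∧ QuatAlg.reducedNorm x = 1) ↔
      ¬ ∃ p : ℕ, p.Prime ∧ p ∣ N ∧ p ≡ 1 [MOD 4]) ∧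
    ((∃ x : QuatAlg.Quat ℚ a b, QuatAlg.reducedTrace x = 1 ∧ QuatAlg.reducedNorm x = 1) ↔
      ¬ ∃ p : ℕ, p.Prime ∧ p ∣ N ∧ p ≡ 1 [MOD 3]) := by
  have h0 := QuatAlg.exists_trace_norm_one_iff_of_hasDiscriminant (ε := 0) ha hb hdisc
  have h1 := QuatAlg.exists_trace_norm_one_iff_of_hasDiscriminant (ε := 1) ha hb hdisc
  rw [Int.cast_zero] at h0
  rw [Int.cast_one] at h1
  rw [h0, h1]
  refine ⟨not_congr ?_, not_congr ?_⟩
  · exact exists_congr fun p => and_congr_right fun hp => and_congr_right fun _ =>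
      QuatAlg.isSplitPrime_zero_iff hp
  · exact exists_congr fun p => and_congr_right fun hp => and_congr_right fun _ =>
      QuatAlg.isSplitPrime_one_iff hp

theorem mainTheorem7 (a b : ℚ) (ha : a ≠ 0) (hb : b ≠ 0) (N : ℕ) (hsq : Squarefree N)
    (hodd : Odd N.primeFactors.card) (hdef : QuatAlg.IsDefinite a b)
    (hdisc : QuatAlg.HasDiscriminant a b N) :
    ((∃ x : QuatAlg.Quat ℚ a b, QuatAlg.reducedTrace x = 0 ∧ QuatAlg.reducedNorm x = 1) ↔
      ¬ ∃ p : ℕ, p.Prime ∧ p ∣ N ∧ p ≡ 1 [MOD 4]) ∧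
    ((∃ x : QuatAlg.Quat ℚ a b, QuatAlg.reducedTrace x = 1 ∧ QuatAlg.reducedNorm x = 1) ↔
      ¬ ∃ p : ℕ, p.Prime ∧ p ∣ N ∧ p ≡ 1 [MOD 3]) :=
  mainTheorem7_general a b ha hb N hdisc
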